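/- **Theorem 5.2.** Let $(M,\{\cdot,\cdot\})$ be a finite-dimensional smooth Poisson manifold (Hausdorff and paracompact), let $g$ be a Riemannian metric on $M$, let $H\in C^\infty(M)$, and let $X_H$ be the Hamilton–Poisson vector field, determined by $X_H f=\{f,H\}$ for all $f\in C^\infty(M)$. Let $C_1,\dots,C_k\in C^\infty(M)$ be Casimir functions, i.e. $\{C_i,f\}=0$ for all $f\in C^\infty(M)$, and let $S$ be a regular symplectic leaf, by which we mean: $S$ is an open subset of the submanifold $\{x\in M: C_1(x)=c_1,\dots,C_k(x)=c_k\}$ for some regular value $c=(c_1,\dots,c_k)$ of $(C_1,\dots,C_k):M\to\mathbb R^k$, and $S$, with the structure of an open submanifold of this level set, is a symplectic leaf of $M$, i.e. a maximal connected integral manifold of the characteristic distribution $x\mapsto\{X_f(x): f\in C^\infty(M)\}\subset T_xM$. Let $x_e\in S$ be an equilibrium point of $X_H$, i.e. $X_H(x_e)=0$. Put $$\sigma_i(x_e)=\frac{\det\big(\langle \operatorname{grad} G^{(i)}_b(x_e),\operatorname{grad} C_a(x_e)\rangle_g\big)_{a,b=1}^k}{\det\big(\langle \operatorname{grad} C_b(x_e),\operatorname{grad}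 C_a(x_e)\rangle_g\big)_{a,b=1}^k},\qquad G^{(i)}_b=\begin{cases}H,& b=i,\\ C_b,& b\ne i,\end{cases}$$ and let $\operatorname{Hess}$ denote the Riemannian Hessian, given in local coordinates by $[\operatorname{Hess}F]_{uv}=\frac{\partial^2F}{\partial x^u\partial x^v}-\Gamma^w_{uv}\frac{\partial F}{\partial x^w}$ with the Christoffel symbols $\Gamma^w_{uv}$ of $g$. If the bilinear form $$\Big(\operatorname{Hess}H(x_e)-\sum_{i=1}^k\sigma_i(x_e)\operatorname{Hess}C_i(x_e)\Big)\Big|_{T_{x_e}S\times T_{x_e}S}$$ is positive definite, then $x_e$ is Lyapunov stable for the dynamics generated by $X_H$ on all of $M$: for every neighbourhood $U$ of $x_e$ in $M$ there is a neighbourhood $V$ of $x_e$ in $M$ such that every solution of $\dot x=X_H(x)$ that starts in $V$ exists for all times $t\ge 0$ and remains in $U$. -/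

import Mathlib

open scoped Manifold ContDiff Topology

noncomputable section

namespace HamiltonPoisson

variable {n : ℕ} {M : Type*} [TopologicalSpace M] [ChartedSpace (EuclideanSpace ℝ (Fin n)) M]

/-! ### Poisson manifolds -/

/-- The algebra of smooth real-valued functions on `M`. -/
abbrev SmoothFun (n : ℕ) (M : Type*) [TopologicalSpace M]
    [ChartedSpace (EuclideanSpace ℝ (Fin n)) M] : Type _ :=
  C^∞⟮𝓡 n, M; ℝ⟯

/-- The differential `df_x : T_x M → ℝ` of a real function. -/
abbrev differential (n : ℕ) {M : Type*} [TopologicalSpace M]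
    [ChartedSpace (EuclideanSpace ℝ (Fin n)) M] (f : M → ℝ) (x : M) (v : TangentSpace (𝓡 n) x) :
    ℝ :=
  mfderiv (𝓡 n) 𝓘(ℝ, ℝ) f x v

/-- A Poisson structure: a Lie bracket on the smooth functions which is a derivation in each
argument. -/
structure PoissonStructure (n : ℕ) (M : Type*) [TopologicalSpace M]
    [ChartedSpace (EuclideanSpace ℝ (Fin n)) M] where
  /-- The Poisson bracket `{f, g}`, which is bilinear over `ℝ`. -/
  bracket : SmoothFun n M →ₗ[ℝ] SmoothFun n M →ₗ[ℝ] SmoothFun n M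
  skew : ∀ f g, bracket f g = - bracket g f
  jacobi : ∀ f g h,
    bracket f (bracket g h) + bracket g (bracket h f) + bracket h (bracket f g) = 0
  leibniz : ∀ f g h, bracket (f * g) h = f * bracket g h + g * bracket f h

namespace PoissonStructure

variable (P : PoissonStructure n M)

/-- `X` is the Hamilton–Poisson vector field `X_H`, i.e. the vector field determined by
`X_H f = {f, H}` for all smooth `f`. -/
def IsHamiltonianVectorField (H : SmoothFun n M) (X : ∀ x : M, TangentSpace (𝓡 n) x) : Prop :=
  ∀ (f : SmoothFun n M) (x : M), differential n f x (X x) = P.bracket f H x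

/-- Casimir functions: they Poisson-commute with every smooth function. -/
def IsCasimir (C : SmoothFun n M) : Prop := ∀ f, P.bracket C f = 0

/-- The characteristic subspace at `x`: the set of all values `X_f(x)` at `x` of Hamiltonian vector
fields. -/
def characteristicSpace (x : M) : Set (TangentSpace (𝓡 n) x) :=
  {v | ∃ f : SmoothFun n M, ∀ h : SmoothFun n M, differential n h x v = P.bracket h f x}

end PoissonStructure

/-! ### Tangent spaces of submanifolds, regular values, symplectic leaves -/

/-- The tangent space `T_x S` of a submanifold `S` of `M`: the velocities at time `0` of the curves
through `x` that run in `S`. -/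
def tangentTo (S : Set M) (x : M) : Set (TangentSpace (𝓡 n) x) :=
  {v | ∃ γ : ℝ → M, γ 0 = x ∧ (∀ᶠ t in 𝓝 0, γ t ∈ S) ∧
    HasMFDerivAt 𝓘(ℝ, ℝ) (𝓡 n) γ 0 ((1 : ℝ →L[ℝ] ℝ).smulRight v)}

/-- The level set `C⁻¹(c)` of a map `C = (C_1, …, C_k)`. -/
def levelSet {k : ℕ} (C : Fin k → SmoothFun n M) (c : Fin k → ℝ) : Set M :=
  {x | ∀ i, C i x = c i}

/-- `c` is a regular value of `C = (C_1, …, C_k) : M → ℝ^k`: the differential of `C` is onto at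
every point of `C⁻¹(c)`. -/
def IsRegularValue {k : ℕ} (C : Fin k → SmoothFun n M) (c : Fin k → ℝ) : Prop :=
  ∀ x ∈ levelSet C c,
    Function.Surjective fun (v : TangentSpace (𝓡 n) x) (i : Fin k) => differential n (C i) x v

/-- `S` is a regular symplectic leaf for the Casimirs `C_1, …, C_k`: it is an open subset of the
submanifold `C⁻¹(c)` for a regular value `c` of `C`, and with this submanifold structure it is a
symplectic leaf, i.e. a maximal connected integral manifold of the characteristic distribution.
(A connected integral manifold is maximal exactly if the trajectories of the Hamiltonian vector
fields cannot leave it; replacing `f` by a multiple, it is enough to look at time `1`.) -/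
structure IsRegularSymplecticLeaf (P : PoissonStructure n M) {k : ℕ} (C : Fin k → SmoothFun n M)
    (S : Set M) : Prop where
  isOpen_in_regular_level :
    ∃ c : Fin k → ℝ, IsRegularValue C c ∧ ∃ U : Set M, IsOpen U ∧ S = U ∩ levelSet C c
  isConnected : IsConnected S
  tangent_eq : ∀ x ∈ S, tangentTo (n := n) S x = P.characteristicSpace x
  maximal : ∀ (f : SmoothFun n M) (X : ∀ x : M, TangentSpace (𝓡 n) x),
    P.IsHamiltonianVectorField f X → ∀ γ : ℝ → M, IsMIntegralCurveOn γ X (Set.Icc 0 1) →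
      γ 0 ∈ S → γ 1 ∈ S

/-! ### Riemannian gradient, Lagrange multipliers and Hessian -/

section Riemannian

variable [IsManifold (𝓡 n) ∞ M]

/-- Smooth Riemannian metrics on `M`. -/
abbrev RiemannianMetricOn (n : ℕ) (M : Type*) [TopologicalSpace M]
    [ChartedSpace (EuclideanSpace ℝ (Fin n)) M] [IsManifold (𝓡 n) ∞ M] : Type _ :=
  Bundle.ContMDiffRiemannianMetric (𝓡 n) ∞ (EuclideanSpace ℝ (Fin n))
    (fun x : M => TangentSpace (𝓡 n) x)

variable (g : RiemannianMetricOn n M)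

theorem exists_grad (f : M → ℝ) (x : M) :
    ∃ u : TangentSpace (𝓡 n) x, ∀ w, g.inner x u w = differential n f x w := by
  have : FiniteDimensional ℝ (TangentSpace (𝓡 n) x) :=
    inferInstanceAs (FiniteDimensional ℝ (EuclideanSpace ℝ (Fin n)))
  let B : TangentSpace (𝓡 n) x →ₗ[ℝ] Module.Dual ℝ (TangentSpace (𝓡 n) x) :=
    (ContinuousLinearMap.coeLM ℝ) ∘ₗ (g.inner x).toLinearMap
  have hB : Function.Injective B := by
    rw [injective_iff_map_eq_zero]
    intro u hu
    by_contra h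
    have h1 := g.pos x u h
    have h2 : g.inner x u u = 0 := LinearMap.congr_fun hu u
    linarith
  have hs : Function.Surjective B :=
    (LinearMap.injective_iff_surjective_of_finrank_eq_finrank
      (Subspace.dual_finrank_eq (K := ℝ)).symm).1 hB
  obtain ⟨u, hu⟩ := hs (mfderiv (𝓡 n) 𝓘(ℝ, ℝ) f x).toLinearMap
  exact ⟨u, fun w => LinearMap.congr_fun hu w⟩

/-- The Riemannian gradient: `⟨grad f (x), w⟩ = df_x(w)` for all `w`. -/
def grad (f : M → ℝ) (x : M) : TangentSpace (𝓡 n) x := (exists_grad g f x).choose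

theorem inner_grad (f : M → ℝ) (x : M) (w : TangentSpace (𝓡 n) x) :
    g.inner x (grad g f x) w = differential n f x w :=
  (exists_grad g f x).choose_spec w

/-- The Gramian matrix with `(a, b)` entry `⟨grad h_b, grad f_a⟩`. -/
def gramian {k : ℕ} (f h : Fin k → M → ℝ) (x : M) : Matrix (Fin k) (Fin k) ℝ :=
  Matrix.of fun a b => g.inner x (grad g (h b) x) (grad g (f a) x)

/-- The Lagrange multiplier function
`σ_i = det Σ^{(F_1,…,F_k)}_{(F_1,…,F_{i-1},G,F_{i+1},…,F_k)} / det Σ^{(F_1,…,F_k)}_{(F_1,…,F_k)}`. -/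
def lagrangeMultiplier {k : ℕ} (F : Fin k → M → ℝ) (G : M → ℝ) (i : Fin k) (x : M) : ℝ :=
  (gramian g F (Function.update F i G) x).det / (gramian g F F x).det

/-- The partial derivative `∂f/∂x^u` on the coordinate space. -/
def partialDeriv (u : Fin n) (f : EuclideanSpace ℝ (Fin n) → ℝ) (y : EuclideanSpace ℝ (Fin n)) :
    ℝ :=
  fderiv ℝ f y (EuclideanSpace.single u 1)

/-- The coordinate vector field `∂/∂x^u` of the chart at `x`, at the point with coordinates `y`. -/
def coordVector (x : M) (y : EuclideanSpace ℝ (Fin n)) (u : Fin n) :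
    TangentSpace (𝓡 n) ((extChartAt (𝓡 n) x).symm y) :=
  mfderiv 𝓘(ℝ, EuclideanSpace ℝ (Fin n)) (𝓡 n) (extChartAt (𝓡 n) x).symm y
    (EuclideanSpace.single u (1 : ℝ) : EuclideanSpace ℝ (Fin n))

/-- The matrix `g_{uv}` of the metric in the chart at `x`, as a function of the coordinates. -/
def metricMatrix (x : M) (y : EuclideanSpace ℝ (Fin n)) : Matrix (Fin n) (Fin n) ℝ :=
  Matrix.of fun u v =>
    g.inner ((extChartAt (𝓡 n) x).symm y) (coordVector x y u) (coordVector x y v)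

/-- The Christoffel symbols `Γ^w_{uv}` of the Levi-Civita connection, at the point `x`, in the chart
at `x`. -/
def christoffel (x : M) (w u v : Fin n) : ℝ :=
  let y := extChartAt (𝓡 n) x x
  (1 / 2) * ∑ l, (metricMatrix g x y)⁻¹ w l *
    (partialDeriv u (fun z => metricMatrix g x z v l) y
      + partialDeriv v (fun z => metricMatrix g x z u l) y
      - partialDeriv l (fun z => metricMatrix g x z u v) y)

/-- The Hessian matrix `∂²G/∂x^u∂x^v - Γ^w_{uv} ∂G/∂x^w` at the point `x`, in the chart at `x`. -/
def hessMatrix (G : M → ℝ) (x : M) : Matrix (Fin n) (Fin n) ℝ :=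
  let y := extChartAt (𝓡 n) x x
  let Gc : EuclideanSpace ℝ (Fin n) → ℝ := G ∘ (extChartAt (𝓡 n) x).symm
  Matrix.of fun u v => partialDeriv u (partialDeriv v Gc) y
    - ∑ w, christoffel g x w u v * partialDeriv w Gc y

/-- The coordinates of a tangent vector at `x` in the chart at `x`. -/
def coords (x : M) (η : TangentSpace (𝓡 n) x) : EuclideanSpace ℝ (Fin n) :=
  mfderiv (𝓡 n) 𝓘(ℝ, EuclideanSpace ℝ (Fin n)) (extChartAt (𝓡 n) x) x η

/-- The Riemannian Hessian `Hess G (x)` as a bilinear form on `T_x M`. -/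
def hess (G : M → ℝ) (x : M) (η ξ : TangentSpace (𝓡 n) x) : ℝ :=
  ∑ u, ∑ v, coords x η u * coords x ξ v * hessMatrix g G x u v

end Riemannian

/-! ### Lyapunov stability -/

/-- `x_e` is a (Lyapunov) stable equilibrium of the dynamics on `M` generated by `X`: the solutions
that start close to `x_e` exist for all times `t ≥ 0` and stay close to `x_e`. -/
def IsStableEquilibrium (X : ∀ x : M, TangentSpace (𝓡 n) x) (xe : M) : Prop :=
  X xe = 0 ∧ ∀ U ∈ 𝓝 xe, ∃ V ∈ 𝓝 xe, ∀ x₀ ∈ V,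
    (∃ γ : ℝ → M, γ 0 = x₀ ∧ IsMIntegralCurveOn γ X (Set.Ici 0)) ∧
    ∀ (γ : ℝ → M) (T : ℝ), γ 0 = x₀ → IsMIntegralCurveOn γ X (Set.Icc 0 T) →
      ∀ t ∈ Set.Icc 0 T, γ t ∈ U

end HamiltonPoisson

/-
The Hamiltonian and the Casimirs are first integrals, and the stability is that of a strict minimum
of a first integral. At the equilibrium `dH` vanishes on the Hamiltonian directions, which span
`T_xe S = ⋂ a, ker (dC a)`, so it is a combination of the `dC a`; by Cramer's rule applied to the
Gram matrix the coefficients are the quotients `σ i`. Hence `L = H - ∑ σ i • C i` has a critical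
point at `xe`, where its second derivative in a chart is the Riemannian Hessian. Being positive on
the common kernel of the `dC a`, this Hessian becomes positive definite once the penalty
`K ∑ (C a - C a xe) ^ 2` is added for large `K`, and the penalized `L` is a conserved function with
a strict local minimum at `xe`: its sublevel sets trap the integral curves. Cutting `X_H` off
outside a compact neighbourhood makes it complete, which gives existence for all times.
-/

noncomputable section

namespace HamiltonPoisson

section IntegralCurves

variable {E : Type*} [NormedAddCommGroup E] [NormedSpace ℝ E]

theorem eventually_exists_hasDerivAt_mem [CompleteSpace E] {Y : E → E} {y₀ : E}
    (hY : ContDiffAt ℝ 1 Y y₀) {s : Set E} (hs : s ∈ 𝓝 y₀) :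
    ∃ ε > 0, ∀ᶠ y in 𝓝 y₀, ∃ c : ℝ → E, c 0 = y ∧
      ∀ t ∈ Set.Ioo (-ε) ε, c t ∈ s ∧ HasDerivAt c (Y (c t)) t := by
  obtain ⟨δ, hδ, a, r, L, K, hr, hPL⟩ := IsPicardLindelof.of_contDiffAt_one hY
  obtain ⟨α, hα, hcont⟩ := (hPL 0).exists_forall_mem_closedBall_eq_hasDerivWithinAt_continuousOn
  simp only [zero_sub, zero_add] at hα hcont
  have hball : Metric.closedBall y₀ (r : ℝ) ∈ 𝓝 y₀ := Metric.closedBall_mem_nhds y₀ hr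
  have hflow : Filter.Tendsto α (𝓝 y₀ ×ˢ 𝓝 0) (𝓝 y₀) := by
    have h := hcont.continuousAt
      (prod_mem_nhds hball (Icc_mem_nhds (neg_lt_zero.2 hδ) hδ))
    rwa [ContinuousAt, (hα y₀ (mem_of_mem_nhds hball)).1, nhds_prod_eq] at h
  obtain ⟨U, hU, T, hT, hUT⟩ := Filter.mem_prod_iff.1 (hflow hs)
  obtain ⟨η, hη, hηT⟩ := Metric.mem_nhds_iff.1 hT
  rw [Real.ball_eq_Ioo, zero_sub, zero_add] at hηT
  refine ⟨min δ η, lt_min hδ hη, ?_⟩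
  filter_upwards [hU, hball] with y hyU hy
  refine ⟨fun t => α (y, t), (hα y hy).1, fun t ht => ⟨hUT ⟨hyU, hηT ?_⟩, ?_⟩⟩
  · exact ⟨(neg_le_neg (min_le_right δ η)).trans_lt ht.1, ht.2.trans_le (min_le_right δ η)⟩
  · have h1 : -δ < t := (neg_le_neg (min_le_left δ η)).trans_lt ht.1
    have h2 : t < δ := ht.2.trans_le (min_le_left δ η)
    exact ((hα y hy).2 t ⟨h1.le, h2.le⟩).hasDerivAt (Icc_mem_nhds h1 h2)

variable {H : Type*} [TopologicalSpace H] {I : ModelWithCorners ℝ E H} [I.Boundaryless]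
  {M : Type*} [TopologicalSpace M] [ChartedSpace H M] [IsManifold I 1 M]

theorem hasMFDerivAt_extChartAt_symm_comp {x p : M} {c : ℝ → E} {t : ℝ}
    (ht : c t ∈ (extChartAt I x).target) (hp : (extChartAt I x).symm (c t) = p)
    {v : TangentSpace I p} (hc : HasDerivAt c (mfderiv I 𝓘(ℝ, E) (extChartAt I x) p v) t) :
    HasMFDerivAt 𝓘(ℝ, ℝ) I ((extChartAt I x).symm ∘ c) t
      ((1 : ℝ →L[ℝ] ℝ).smulRight v : ℝ →L[ℝ] TangentSpace I p) := by
  subst hp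
  have hsymm : MDifferentiableAt 𝓘(ℝ, E) I (extChartAt I x).symm (c t) := by
    simpa only [I.range_eq_univ, mdifferentiableWithinAt_univ] using
      mdifferentiableWithinAt_extChartAt_symm (I := I) ht
  have hinv := mfderivWithin_extChartAt_symm_comp_mfderiv_extChartAt (I := I) ht
  rw [I.range_eq_univ, mfderivWithin_univ] at hinv
  refine (HasMFDerivAt.comp t hsymm.hasMFDerivAt hc.hasFDerivAt.hasMFDerivAt).congr_mfderiv
    (ContinuousLinearMap.ext fun s : ℝ => ?_)
  change mfderiv 𝓘(ℝ, E) I (extChartAt I x).symm (c t) (s • _) = s • v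
  exact (map_smul _ s _).trans (congrArg (s • ·) (DFunLike.congr_fun hinv v))

/-- The coordinate expression of the vector field `X` in the chart at `x`. -/
def chartField (x : M) (X : ∀ p : M, TangentSpace I p) (y : E) : E :=
  mfderiv I 𝓘(ℝ, E) (extChartAt I x) ((extChartAt I x).symm y) (X ((extChartAt I x).symm y))

theorem contDiffAt_chartField {X : ∀ p : M, TangentSpace I p} {x : M}
    (hX : CMDiffAt 1 (T% X) x) :
    ContDiffAt ℝ 1 (chartField x X) (extChartAt I x x) := by
  have hcomp : CMDiffAt 1 ((fun p => (trivializationAt E (TangentSpace I) x ⟨p, X p⟩).2) ∘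
      (extChartAt I x).symm) (extChartAt I x x) := by
    refine ContMDiffAt.comp _ ?_ ((contMDiffOn_extChartAt_symm x).contMDiffAt
      (extChartAt_target_mem_nhds x))
    rw [extChartAt_to_inv]
    exact Bundle.contMDiffAt_section _ |>.1 hX
  refine hcomp.contDiffAt.congr_of_eventuallyEq ?_
  filter_upwards [extChartAt_target_mem_nhds (I := I) x] with y hy
  have hsource : (extChartAt I x).symm y ∈ (chartAt H x).source := by
    simpa only [extChartAt_source] using (extChartAt I x).map_target hy
  have hderiv := TangentBundle.continuousLinearMapAt_trivializationAt (I := I) hsource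
  exact (DFunLike.congr_fun hderiv _).symm.trans
    (Bundle.Trivialization.continuousLinearMapAt_apply_of_mem ℝ _ hsource _)

theorem eventually_exists_isMIntegralCurveOn [CompleteSpace E] {X : ∀ p : M, TangentSpace I p}
    {x : M} (hX : CMDiffAt 1 (T% X) x) :
    ∃ ε > 0, ∀ᶠ p in 𝓝 x, ∃ γ : ℝ → M, γ 0 = p ∧ IsMIntegralCurveOn γ X (Set.Ioo (-ε) ε) := by
  obtain ⟨ε, hε, h⟩ := eventually_exists_hasDerivAt_mem (contDiffAt_chartField hX)
    (extChartAt_target_mem_nhds x)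
  refine ⟨ε, hε, ?_⟩
  filter_upwards [(continuousAt_extChartAt x).eventually h, extChartAt_source_mem_nhds (I := I) x]
    with p ⟨c, hc0, hc⟩ hp
  refine ⟨(extChartAt I x).symm ∘ c, ?_, fun t ht => ?_⟩
  · rw [Function.comp_apply, hc0, (extChartAt I x).left_inv hp]
  · exact (hasMFDerivAt_extChartAt_symm_comp (hc t ht).1 rfl (hc t ht).2).hasMFDerivWithinAt

theorem exists_isMIntegralCurve_of_eq_zero_off_isCompact [CompleteSpace E] [T2Space M]
    {X : ∀ p : M, TangentSpace I p} (hX : CMDiff 1 (T% X))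
    {K : Set M} (hK : IsCompact K) (hXK : ∀ p ∉ K, X p = 0) (x : M) :
    ∃ γ : ℝ → M, γ 0 = x ∧ IsMIntegralCurve γ X := by
  obtain ⟨ε, hε, hcurve⟩ : ∃ ε > 0, ∀ p ∈ K, ∃ γ : ℝ → M, γ 0 = p ∧
      IsMIntegralCurveOn γ X (Set.Ioo (-ε) ε) := by
    refine hK.induction_on ⟨1, one_pos, by simp⟩ ?_ ?_ ?_
    · rintro s t hst ⟨ε, hε, h⟩
      exact ⟨ε, hε, fun p hp => h p (hst hp)⟩
    · rintro s t ⟨ε, hε, h⟩ ⟨δ, hδ, h'⟩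
      refine ⟨min ε δ, lt_min hε hδ, fun p hp => ?_⟩
      rcases hp with hp | hp
      · obtain ⟨γ, h0, hγ⟩ := h p hp
        exact ⟨γ, h0, hγ.mono (Set.Ioo_subset_Ioo (neg_le_neg (min_le_left _ _))
          (min_le_left _ _))⟩
      · obtain ⟨γ, h0, hγ⟩ := h' p hp
        exact ⟨γ, h0, hγ.mono (Set.Ioo_subset_Ioo (neg_le_neg (min_le_right _ _))
          (min_le_right _ _))⟩
    · intro p _
      obtain ⟨ε, hε, h⟩ := eventually_exists_isMIntegralCurveOn (hX p)
      exact ⟨_, mem_nhdsWithin_of_mem_nhds h, ε, hε, fun q hq => hq⟩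
  refine exists_isMIntegralCurve_of_isMIntegralCurveOn hX hε (fun p => ?_) x
  by_cases hp : p ∈ K
  · exact hcurve p hp
  · exact ⟨fun _ => p, rfl, (isMIntegralCurve_const (hXK p hp)).isMIntegralCurveOn _⟩

end IntegralCurves

section SecondDerivativeTest

variable {E F : Type*} [NormedAddCommGroup E] [NormedSpace ℝ E] [NormedAddCommGroup F]
  [NormedSpace ℝ F]

theorem isLittleO_taylor_two {f : E → F} {f' : E → E →L[ℝ] F} {f'' : E →L[ℝ] E →L[ℝ] F} {x : E}
    (hf : ∀ᶠ y in 𝓝 x, HasFDerivAt f (f' y) y) (hf' : HasFDerivAt f' f'' x) :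
    (fun y => f y - f x - f' x (y - x) - (1 / 2 : ℝ) • f'' (y - x) (y - x))
      =o[𝓝 x] fun y => ‖y - x‖ ^ 2 := by
  obtain ⟨r, hr, hball⟩ := Metric.eventually_nhds_iff_ball.1 hf
  have hderiv : ∀ y ∈ Metric.ball x r, HasFDerivWithinAt
      (fun y => f y - f' x (y - x) - (1 / 2 : ℝ) • f'' (y - x) (y - x))
      (f' y - f' x - f'' (y - x)) (Metric.ball x r) y := fun y hy => by
    have hsub : HasFDerivAt (fun y => y - x) (ContinuousLinearMap.id ℝ E) y :=
      (hasFDerivAt_id y).sub_const x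
    refine (((hball y hy).fun_sub ((f' x).hasFDerivAt.comp y hsub)).fun_sub
      (((f''.hasFDerivAt.comp y hsub).clm_apply hsub).const_smul
        (1 / 2 : ℝ))).hasFDerivWithinAt.congr_fderiv (ContinuousLinearMap.ext fun v => ?_)
    have hsymm := second_derivative_symmetric_of_eventually hf hf' v (y - x)
    simp only [ContinuousLinearMap.comp_id, sub_apply, smul_apply, add_apply,
      ContinuousLinearMap.flip_apply, Function.comp_apply, hsymm]
    module
  have hlittle : (fun y => f' y - f' x - f'' (y - x))
      =o[𝓝[Metric.ball x r] x] fun y => ‖y - x‖ ^ 1 := by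
    simpa only [pow_one] using hf'.isLittleO.norm_right.mono nhdsWithin_le_nhds
  have h := (convex_ball x r).isLittleO_pow_succ (Metric.mem_ball_self hr) hderiv hlittle
  rw [Metric.isOpen_ball.nhdsWithin_eq (Metric.mem_ball_self hr)] at h
  refine h.congr_left fun y => ?_
  simp only [sub_self, map_zero, smul_zero, sub_zero]
  abel

variable {ι : Type*} [Fintype ι]

/- Finsler's lemma, obtained by exhausting the unit sphere. -/
theorem exists_coercive_penalty [FiniteDimensional ℝ E] (B : E →L[ℝ] E →L[ℝ] ℝ)
    (ℓ : ι → E →L[ℝ] ℝ) (hB : ∀ v ≠ 0, (∀ i, ℓ i v = 0) → 0 < B v v) :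
    ∃ K : ℝ, ∃ c > 0, ∀ v, c * ‖v‖ ^ 2 ≤ B v v + K * ∑ i, ℓ i v ^ 2 := by
  have hlarge : ∀ v ≠ 0, ∃ m : ℕ, 1 / (m + 1 : ℝ) < B v v + m * ∑ i, ℓ i v ^ 2 := by
    intro v hv
    rcases (Finset.sum_nonneg fun i _ => sq_nonneg (ℓ i v)).eq_or_lt with h0 | hpos
    · have hker : ∀ i, ℓ i v = 0 := fun i => pow_eq_zero_iff two_ne_zero |>.1 <|
        (Finset.sum_eq_zero_iff_of_nonneg fun i _ => sq_nonneg (ℓ i v)).1 h0.symm i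
          (Finset.mem_univ i)
      simpa only [← h0, mul_zero, add_zero] using exists_nat_one_div_lt (hB v hv hker)
    · obtain ⟨m, hm⟩ := exists_nat_gt ((1 - B v v) / ∑ i, ℓ i v ^ 2)
      rw [div_lt_iff₀ hpos, sub_lt_iff_lt_add'] at hm
      exact ⟨m, hm.trans_le' (div_le_one_of_le₀ (by simp) (by positivity))⟩
  have hmono : Monotone fun m : ℕ => {v | 1 / (m + 1 : ℝ) < B v v + m * ∑ i, ℓ i v ^ 2} := by
    intro m m' hmm' v (hv : 1 / (m + 1 : ℝ) < B v v + m * ∑ i, ℓ i v ^ 2)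
    calc 1 / (m' + 1 : ℝ) ≤ 1 / (m + 1 : ℝ) := by gcongr
      _ < B v v + m * ∑ i, ℓ i v ^ 2 := hv
      _ ≤ B v v + m' * ∑ i, ℓ i v ^ 2 := by gcongr
  obtain ⟨m, hm⟩ := (isCompact_sphere (0 : E) 1).elim_directed_cover _
    (fun m => isOpen_lt (by fun_prop) (by fun_prop))
    (fun v hv => Set.mem_iUnion.2 (hlarge v (ne_zero_of_mem_unit_sphere ⟨v, hv⟩)))
    hmono.directed_le
  refine ⟨m, 1 / (m + 1), by positivity, fun v => ?_⟩
  rcases eq_or_ne v 0 with rfl | hv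
  · simp
  have hunit := hm (by simp [norm_smul, hv] : ‖v‖⁻¹ • v ∈ Metric.sphere (0 : E) 1)
  simp only [Set.mem_ofPred_eq, map_smul, smul_apply, smul_eq_mul, mul_pow,
    ← Finset.mul_sum] at hunit
  calc 1 / (m + 1 : ℝ) * ‖v‖ ^ 2
      ≤ (‖v‖⁻¹ * (‖v‖⁻¹ * B v v) + m * (‖v‖⁻¹ ^ 2 * ∑ i, ℓ i v ^ 2)) * ‖v‖ ^ 2 := by gcongr
    _ = B v v + m * ∑ i, ℓ i v ^ 2 := by field_simp

theorem isLittleO_sq_sub_sq {q : E → ℝ} {x : E} (hq : DifferentiableAt ℝ q x) :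
    (fun y => (q y - q x) ^ 2 - fderiv ℝ q x (y - x) ^ 2) =o[𝓝 x] fun y => ‖y - x‖ ^ 2 := by
  have hsub := hq.hasFDerivAt.isLittleO
  have hadd : (fun y => q y - q x + fderiv ℝ q x (y - x)) =O[𝓝 x] fun y => y - x :=
    hq.hasFDerivAt.isBigO_sub.add ((fderiv ℝ q x).isBigO_sub _ x)
  refine (hadd.norm_right.mul_isLittleO hsub.norm_right).congr (fun y => ?_) fun y => ?_ <;> ring

theorem eventually_lt_add_penalty [FiniteDimensional ℝ E] {f : E → ℝ} {q : ι → E → ℝ} {x : E}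
    (hf : ContDiffAt ℝ 2 f x) (hq : ∀ i, DifferentiableAt ℝ (q i) x) (hcrit : fderiv ℝ f x = 0)
    (hpos : ∀ v ≠ 0, (∀ i, fderiv ℝ (q i) x v = 0) → 0 < fderiv ℝ (fderiv ℝ f) x v v) :
    ∃ K : ℝ, ∀ᶠ y in 𝓝[≠] x, f x < f y + K * ∑ i, (q i y - q i x) ^ 2 := by
  obtain ⟨K, c, hc, hK⟩ := exists_coercive_penalty (fderiv ℝ (fderiv ℝ f) x) _ hpos
  refine ⟨K / 2, ?_⟩
  have htaylor := isLittleO_taylor_two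
    ((hf.eventually (by simp)).mono fun y hy => (hy.differentiableAt two_ne_zero).hasFDerivAt)
    ((hf.fderiv_right (m := 1) (by norm_num)).differentiableAt one_ne_zero).hasFDerivAt
  have hpenalty : (fun y => ∑ i, ((q i y - q i x) ^ 2 - fderiv ℝ (q i) x (y - x) ^ 2))
      =o[𝓝 x] fun y => ‖y - x‖ ^ 2 :=
    Asymptotics.IsLittleO.fun_sum fun i _ => isLittleO_sq_sub_sq (hq i)
  have hremainder :=
    (htaylor.add (hpenalty.const_mul_left (K / 2))).def (c := c / 4) (by positivity)
  filter_upwards [nhdsWithin_le_nhds hremainder, self_mem_nhdsWithin] with y hy hne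
  have hnorm : 0 < ‖y - x‖ ^ 2 := pow_pos (norm_pos_iff.2 (sub_ne_zero.2 hne)) 2
  have hlower := (abs_le.1 hy).1
  simp only [hcrit, zero_apply, Finset.sum_sub_distrib, smul_eq_mul, norm_pow, norm_norm] at hlower
  nlinarith [hK (y - x)]

end SecondDerivativeTest

section Confinement

theorem subset_interior_of_disjoint_frontier {X : Type*} [TopologicalSpace X] {s K : Set X}
    (hs : IsPreconnected s) (hsK : Disjoint s (frontier K)) (hne : (s ∩ interior K).Nonempty) :
    s ⊆ interior K := by
  refine hs.subset_left_of_subset_union isOpen_interior isClosed_closure.isOpen_compl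
    (Set.disjoint_compl_right_iff_subset.2 interior_subset_closure) (fun x hx => ?_) hne
  by_cases hxK : x ∈ interior K
  · exact Or.inl hxK
  · exact Or.inr fun hcl => Set.disjoint_left.1 hsK hx ⟨hcl, hxK⟩

variable {E : Type*} [NormedAddCommGroup E] [NormedSpace ℝ E] {H : Type*} [TopologicalSpace H]
  {I : ModelWithCorners ℝ E H} {M : Type*} [TopologicalSpace M] [ChartedSpace H M]
  {X : ∀ p : M, TangentSpace I p}

theorem apply_eq_of_isMIntegralCurveOn {F : Type*} [NormedAddCommGroup F] [NormedSpace ℝ F]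
    {f : M → F} (hf : MDiff f) (hfX : ∀ p, mfderiv I 𝓘(ℝ, F) f p (X p) = 0) {γ : ℝ → M}
    {s : Set ℝ} (hs : Convex ℝ s) (hγ : IsMIntegralCurveOn γ X s) {a b : ℝ} (ha : a ∈ s)
    (hb : b ∈ s) : f (γ b) = f (γ a) := by
  have hderiv : ∀ t ∈ s, HasDerivWithinAt (f ∘ γ) 0 s t := fun t ht => by
    have hcomp := ((hf (γ t)).hasMFDerivAt.comp_hasMFDerivWithinAt t (hγ t ht)).hasFDerivWithinAt
    refine hasDerivWithinAt_iff_hasFDerivWithinAt.2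
      (hcomp.congr_fderiv (ContinuousLinearMap.ext_ring ?_))
    exact ((map_smul _ (1 : ℝ) _).trans (congrArg _ (hfX (γ t)))).trans rfl
  have hle := hs.norm_image_sub_le_of_norm_hasDerivWithin_le hderiv
    (fun t _ => norm_zero.le) ha hb
  rwa [zero_mul, norm_le_zero_iff, sub_eq_zero] at hle

theorem mapsTo_interior_of_le_frontier {f : M → ℝ} (hf : MDiff f)
    (hfX : ∀ p, mfderiv I 𝓘(ℝ, ℝ) f p (X p) = 0) {K : Set M} {m : ℝ}
    (hm : ∀ p ∈ frontier K, m ≤ f p) {γ : ℝ → M} {s : Set ℝ} (hs : Convex ℝ s)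
    (hγ : IsMIntegralCurveOn γ X s) {a : ℝ} (ha : a ∈ s) (haK : γ a ∈ interior K)
    (ham : f (γ a) < m) : Set.MapsTo γ s (interior K) := by
  refine Set.mapsTo_iff_image_subset.2 <| subset_interior_of_disjoint_frontier
    (hs.isPreconnected.image γ hγ.continuousOn) (Set.disjoint_left.2 ?_)
    ⟨γ a, Set.mem_image_of_mem γ ha, haK⟩
  rintro _ ⟨t, ht, rfl⟩ hfront
  rw [← apply_eq_of_isMIntegralCurveOn hf hfX hs hγ ha ht] at ham
  exact (hm _ hfront).not_gt ham

theorem exists_isMIntegralCurve_of_le_frontier [CompleteSpace E] [I.Boundaryless]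
    [IsManifold I 1 M] [T2Space M] (hX : CMDiff 1 (T% X)) {f : M → ℝ} (hf : MDiff f)
    (hfX : ∀ p, mfderiv I 𝓘(ℝ, ℝ) f p (X p) = 0) {K : Set M} {m : ℝ}
    (hm : ∀ p ∈ frontier K, m ≤ f p) {ρ : M → ℝ} (hρ : CMDiff 1 ρ) (hcs : HasCompactSupport ρ)
    (hρK : ∀ p ∈ K, ρ p = 1) {x : M} (hxK : x ∈ interior K) (hxm : f x < m) :
    ∃ γ : ℝ → M, γ 0 = x ∧ IsMIntegralCurve γ X := by
  obtain ⟨γ, h0, hγ⟩ := exists_isMIntegralCurve_of_eq_zero_off_isCompact (X := ρ • X)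
    (hρ.smul_section hX) hcs
    (fun p hp => by rw [Pi.smul_apply', image_eq_zero_of_notMem_tsupport hp, zero_smul]) x
  refine ⟨γ, h0, fun t => ?_⟩
  have hmem : γ t ∈ interior K := by
    refine mapsTo_interior_of_le_frontier hf (fun p => ?_) hm convex_univ
      (hγ.isMIntegralCurveOn Set.univ) (Set.mem_univ 0) (h0 ▸ hxK) (h0 ▸ hxm) (Set.mem_univ t)
    exact (map_smul _ (ρ p) (X p)).trans ((congrArg _ (hfX p)).trans (smul_zero _))
  have hXt : (ρ • X) (γ t) = X (γ t) := by
    rw [Pi.smul_apply', hρK _ (interior_subset hmem), one_smul]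
  exact hXt ▸ hγ t

end Confinement

section Lyapunov

variable {n : ℕ} {M : Type*} [TopologicalSpace M] [ChartedSpace (EuclideanSpace ℝ (Fin n)) M]

theorem SmoothFun.hasMFDerivAt (f : SmoothFun n M) (x : M) :
    HasMFDerivAt (𝓡 n) 𝓘(ℝ, ℝ) f x (mfderiv (𝓡 n) 𝓘(ℝ, ℝ) f x) :=
  (f.contMDiff.mdifferentiable (by simp) x).hasMFDerivAt

theorem differential_mul (f h : SmoothFun n M) (x : M) (v : TangentSpace (𝓡 n) x) :
    differential n (f * h : SmoothFun n M) x v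
      = f x * differential n h x v + h x * differential n f x v :=
  DFunLike.congr_fun ((f.hasMFDerivAt x).mul (h.hasMFDerivAt x)).mfderiv v

theorem isLinearMap_differential (x : M) (v : TangentSpace (𝓡 n) x) :
    IsLinearMap ℝ fun f : SmoothFun n M => differential n f x v where
  map_add f h := DFunLike.congr_fun ((f.hasMFDerivAt x).add (h.hasMFDerivAt x)).mfderiv v
  map_smul c f := DFunLike.congr_fun ((f.hasMFDerivAt x).const_smul c).mfderiv v

/-- The algebra of the smooth first integrals of the dynamics generated by `X`. -/
def firstIntegrals (X : ∀ x : M, TangentSpace (𝓡 n) x) : Subalgebra ℝ (SmoothFun n M) where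
  carrier := {f | ∀ x, differential n f x (X x) = 0}
  mul_mem' {f h} hf hh x := by rw [differential_mul, hf, hh, mul_zero, mul_zero, add_zero]
  add_mem' {f h} hf hh x := by rw [(isLinearMap_differential x (X x)).map_add, hf, hh, add_zero]
  algebraMap_mem' r x := DFunLike.congr_fun (mfderiv_const (c := r)) (X x)

theorem isStableEquilibrium_of_eventually_lt [IsManifold (𝓡 n) ∞ M] [T2Space M]
    {X : ∀ x : M, TangentSpace (𝓡 n) x} (hX : ContMDiff (𝓡 n) (𝓡 n).tangent 1 (T% X))
    {xe : M} (heq : X xe = 0) {Φ : SmoothFun n M} (hΦ : Φ ∈ firstIntegrals X)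
    (hmin : ∀ᶠ p in 𝓝[≠] xe, Φ xe < Φ p) :
    IsStableEquilibrium X xe := by
  refine ⟨heq, fun U hU => ?_⟩
  have : LocallyCompactSpace M := Manifold.locallyCompact_of_finiteDimensional (𝓡 n)
  have : IsManifold (𝓡 n) 1 M := .of_le (n := ∞) (by simp)
  obtain ⟨ρ⟩ : Nonempty (SmoothBumpFunction (𝓡 n) xe) := inferInstance
  have hΦd : MDifferentiable (𝓡 n) 𝓘(ℝ, ℝ) Φ := Φ.contMDiff.mdifferentiable (by simp)
  obtain ⟨K, hKnhds, hKsub, hK⟩ := local_compact_nhds (Filter.inter_mem hU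
    (Filter.inter_mem ρ.eventuallyEq_one (eventually_nhdsWithin_iff.1 hmin)))
  have hfrontier : frontier K ⊆ K := hK.isClosed.frontier_subset
  have hxe : xe ∈ interior K := mem_interior_iff_mem_nhds.2 hKnhds
  obtain ⟨m, hm, hmK⟩ := (hK.of_isClosed_subset isClosed_frontier hfrontier).exists_forall_le'
    Φ.contMDiff.continuous.continuousOn
    fun p hp => (hKsub (hfrontier hp)).2.2 (ne_of_mem_of_not_mem hxe hp.2).symm
  refine ⟨interior K ∩ {p | Φ p < m}, Filter.inter_mem (isOpen_interior.mem_nhds hxe)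
    (Φ.contMDiff.continuous.continuousAt.eventually_lt_const hm), fun x₀ hx₀ => ⟨?_, ?_⟩⟩
  · obtain ⟨γ, h0, hγ⟩ := exists_isMIntegralCurve_of_le_frontier hX hΦd hΦ hmK
      (ρ.contMDiff.of_le (by simp)) ρ.hasCompactSupport (fun p hp => (hKsub hp).2.1) hx₀.1 hx₀.2
    exact ⟨γ, h0, hγ.isMIntegralCurveOn _⟩
  · intro γ T h0 hγ t ht
    exact (hKsub (interior_subset (mapsTo_interior_of_le_frontier hΦd hΦ hmK (convex_Icc 0 T) hγ
      (Set.left_mem_Icc.2 (ht.1.trans ht.2)) (h0 ▸ hx₀.1) (h0 ▸ hx₀.2) ht))).1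

end Lyapunov

section LocalRepresentative

variable {n : ℕ} {M : Type*} [TopologicalSpace M] [ChartedSpace (EuclideanSpace ℝ (Fin n)) M]

/-- The coordinate expression of the function `f` in the chart at `x`. -/
abbrev localRep (x : M) (f : M → ℝ) : EuclideanSpace ℝ (Fin n) → ℝ :=
  f ∘ (extChartAt (𝓡 n) x).symm

theorem differential_eq_fderiv_localRep (x : M) (f : SmoothFun n M) (v : TangentSpace (𝓡 n) x) :
    differential n f x v = fderiv ℝ (localRep x f) (extChartAt (𝓡 n) x x) v := by
  rw [differential, (f.contMDiff.mdifferentiable (by simp) x).mfderiv,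
    ModelWithCorners.range_eq_univ, fderivWithin_univ]
  rfl

variable [IsManifold (𝓡 n) ∞ M]

theorem contDiffAt_localRep (x : M) (f : SmoothFun n M) :
    ContDiffAt ℝ ∞ (localRep x f) (extChartAt (𝓡 n) x x) :=
  (f.contMDiff.comp_contMDiffOn (contMDiffOn_extChartAt_symm (n := ∞) x)).contMDiffAt
    (extChartAt_target_mem_nhds x) |>.contDiffAt

theorem coords_eq_self (x : M) (v : TangentSpace (𝓡 n) x) : coords x v = v := by
  rw [coords, mfderiv_extChartAt_self]
  rfl

end LocalRepresentative

section Hessian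

variable {n : ℕ}

theorem partialDeriv_partialDeriv {f : EuclideanSpace ℝ (Fin n) → ℝ}
    {y : EuclideanSpace ℝ (Fin n)} (hf : ContDiffAt ℝ 2 f y) (u v : Fin n) :
    partialDeriv u (partialDeriv v f) y
      = fderiv ℝ (fderiv ℝ f) y (EuclideanSpace.single u 1) (EuclideanSpace.single v 1) := by
  have hd : DifferentiableAt ℝ (fderiv ℝ f) y :=
    (hf.fderiv_right (m := 1) (by norm_num)).differentiableAt one_ne_zero
  exact DFunLike.congr_fun (hd.hasFDerivAt.clm_apply (hasFDerivAt_const _ y)).fderiv _ |>.trans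
    (by simp)

theorem bilin_apply_eq_sum
    (D : EuclideanSpace ℝ (Fin n) →L[ℝ] EuclideanSpace ℝ (Fin n) →L[ℝ] ℝ)
    (v w : EuclideanSpace ℝ (Fin n)) :
    D v w = ∑ i, ∑ j, v i * w j * D (EuclideanSpace.single i 1) (EuclideanSpace.single j 1) := by
  have hsum := fun v => (EuclideanSpace.basisFun (Fin n) ℝ).sum_repr v
  conv_lhs => rw [← hsum v, ← hsum w]
  simp only [EuclideanSpace.basisFun_repr, EuclideanSpace.basisFun_apply, map_sum, map_smul,
    sum_apply, smul_apply, smul_eq_mul, Finset.mul_sum, mul_assoc]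
  rw [Finset.sum_comm]
  exact Finset.sum_congr rfl fun i _ => Finset.sum_congr rfl fun j _ => mul_left_comm _ _ _

variable {M : Type*} [TopologicalSpace M] [ChartedSpace (EuclideanSpace ℝ (Fin n)) M]
  [IsManifold (𝓡 n) ∞ M] (g : RiemannianMetricOn n M)

theorem hessMatrix_apply (f : SmoothFun n M) (x : M) (u v : Fin n) :
    hessMatrix g f x u v
      = fderiv ℝ (fderiv ℝ (localRep x f)) (extChartAt (𝓡 n) x x) (EuclideanSpace.single u 1)
          (EuclideanSpace.single v 1)
        - ∑ w, christoffel g x w u v *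
          fderiv ℝ (localRep x f) (extChartAt (𝓡 n) x x) (EuclideanSpace.single w 1) := by
  rw [← partialDeriv_partialDeriv ((contDiffAt_localRep x f).of_le (by norm_cast))]
  rfl

theorem isLinearMap_hessMatrix (x : M) (u v : Fin n) :
    IsLinearMap ℝ fun f : SmoothFun n M => hessMatrix g f x u v := by
  have hd1 : ∀ f : SmoothFun n M, DifferentiableAt ℝ (localRep x f) (extChartAt (𝓡 n) x x) :=
    fun f => (contDiffAt_localRep x f).differentiableAt (by simp)
  have hd2 : ∀ f : SmoothFun n M, ContDiffAt ℝ (2 : ℕ) (localRep x f) (extChartAt (𝓡 n) x x) :=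
    fun f => (contDiffAt_localRep x f).of_le (by norm_cast)
  have happly : ∀ f : SmoothFun n M, hessMatrix g f x u v
      = iteratedFDeriv ℝ 2 (localRep x f) (extChartAt (𝓡 n) x x)
          ![EuclideanSpace.single u 1, EuclideanSpace.single v 1]
        - ∑ w, christoffel g x w u v *
          fderiv ℝ (localRep x f) (extChartAt (𝓡 n) x x) (EuclideanSpace.single w 1) := fun f => by
    rw [iteratedFDeriv_two_apply, hessMatrix_apply]
    rfl
  refine ⟨fun f h => ?_, fun c f => ?_⟩
  · have hrep : localRep (n := n) x (f + h : SmoothFun n M) = localRep x f + localRep x h := rfl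
    simp only [happly, hrep, iteratedFDeriv_add_apply (hd2 f) (hd2 h), fderiv_add (hd1 f) (hd1 h),
      add_apply, mul_add, Finset.sum_add_distrib]
    ring
  · have hrep : localRep (n := n) x (c • f : SmoothFun n M) = c • localRep x f := rfl
    simp only [happly, hrep, iteratedFDeriv_const_smul_apply (hd2 f), fderiv_const_smul (hd1 f),
      smul_apply, smul_sub, Finset.smul_sum, mul_smul_comm]

theorem isLinearMap_hess (x : M) (v w : TangentSpace (𝓡 n) x) :
    IsLinearMap ℝ fun f : SmoothFun n M => hess g f x v w where
  map_add f h := by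
    simp only [hess, (isLinearMap_hessMatrix g x _ _).map_add, mul_add, Finset.sum_add_distrib]
  map_smul c f := by
    simp only [hess, (isLinearMap_hessMatrix g x _ _).map_smul, Finset.smul_sum, mul_smul_comm]

theorem hess_eq_of_fderiv_eq_zero {f : SmoothFun n M} {x : M}
    (hf : fderiv ℝ (localRep x f) (extChartAt (𝓡 n) x x) = 0) (v w : TangentSpace (𝓡 n) x) :
    hess g f x v w = fderiv ℝ (fderiv ℝ (localRep x f)) (extChartAt (𝓡 n) x x) v w := by
  refine Eq.trans ?_ (bilin_apply_eq_sum _ v w).symm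
  simp only [hess, coords_eq_self, hessMatrix_apply, hf, zero_apply, mul_zero,
    Finset.sum_const_zero, sub_zero]

end Hessian

section EnergyCasimir

variable {n : ℕ} {M : Type*} [TopologicalSpace M] [ChartedSpace (EuclideanSpace ℝ (Fin n)) M]
  [IsManifold (𝓡 n) ∞ M]

theorem eventually_lt_add_sum_sq (g : RiemannianMetricOn n M) {ι : Type*} [Fintype ι]
    {L : SmoothFun n M} {C : ι → SmoothFun n M} {x : M} (hcrit : ∀ v, differential n L x v = 0)
    (hpos : ∀ v ≠ 0, (∀ i, differential n (C i) x v = 0) → 0 < hess g L x v v) :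
    ∃ K : ℝ, ∀ᶠ p in 𝓝[≠] x, L x < L p + K * ∑ i, (C i p - C i x) ^ 2 := by
  have hcrit' : fderiv ℝ (localRep x L) (extChartAt (𝓡 n) x x) = 0 :=
    ContinuousLinearMap.ext fun v => (differential_eq_fderiv_localRep x L v).symm.trans (hcrit v)
  obtain ⟨K, hK⟩ := eventually_lt_add_penalty ((contDiffAt_localRep x L).of_le (by norm_cast))
    (fun i => (contDiffAt_localRep x (C i)).differentiableAt (by simp)) hcrit' fun v hv hvC =>
      (hpos v hv fun i => (differential_eq_fderiv_localRep x (C i) v).trans (hvC i)).trans_eq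
        (hess_eq_of_fderiv_eq_zero g hcrit' v v)
  have hchart : Filter.Tendsto (extChartAt (𝓡 n) x) (𝓝[≠] x) (𝓝[≠] (extChartAt (𝓡 n) x x)) := by
    refine tendsto_nhdsWithin_iff.2
      ⟨(continuousAt_extChartAt x).tendsto.mono_left nhdsWithin_le_nhds, ?_⟩
    filter_upwards [self_mem_nhdsWithin,
      nhdsWithin_le_nhds (extChartAt_source_mem_nhds (I := 𝓡 n) x)] with p hne hp
    exact (extChartAt (𝓡 n) x).injOn.ne hp (mem_extChartAt_source x) hne
  refine ⟨K, ?_⟩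
  filter_upwards [hchart.eventually hK,
    nhdsWithin_le_nhds (extChartAt_source_mem_nhds (I := 𝓡 n) x)] with p hlt hp
  simpa only [localRep, Function.comp_apply, extChartAt_to_inv, (extChartAt (𝓡 n) x).left_inv hp]
    using hlt

theorem isStableEquilibrium_of_hess_pos (g : RiemannianMetricOn n M) [T2Space M]
    {X : ∀ x : M, TangentSpace (𝓡 n) x} (hX : ContMDiff (𝓡 n) (𝓡 n).tangent 1 (T% X)) {xe : M}
    (heq : X xe = 0) {ι : Type*} [Finite ι] {L : SmoothFun n M} {C : ι → SmoothFun n M}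
    (hL : L ∈ firstIntegrals X) (hC : ∀ i, C i ∈ firstIntegrals X)
    (hcrit : ∀ v, differential n L xe v = 0)
    (hpos : ∀ v ≠ 0, (∀ i, differential n (C i) xe v = 0) → 0 < hess g L xe v v) :
    IsStableEquilibrium X xe := by
  cases nonempty_fintype ι
  obtain ⟨K, hK⟩ := eventually_lt_add_sum_sq g hcrit hpos
  let Φ : SmoothFun n M := L + K • ∑ i, (C i - algebraMap ℝ _ (C i xe)) ^ 2
  have hΦ : Φ ∈ firstIntegrals X :=
    add_mem hL (Subalgebra.smul_mem _ (sum_mem fun i _ =>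
      pow_mem (sub_mem (hC i) (Subalgebra.algebraMap_mem _ _)) 2) K)
  have hΦ_apply : ∀ p, Φ p = L p + K * ∑ i, (C i p - C i xe) ^ 2 := fun p =>
    congrArg (L p + K * ·) (map_sum (ContMDiffMap.evalRingHom p) _ _)
  refine isStableEquilibrium_of_eventually_lt hX heq hΦ (hK.mono fun p hp => ?_)
  simpa [hΦ_apply] using hp

end EnergyCasimir

section LagrangeMultipliers

theorem exists_eq_sum_of_forall_apply_eq_zero {𝕜 V ι : Type*} [Field 𝕜] [AddCommGroup V]
    [Module 𝕜 V] [Fintype ι] {f : Module.Dual 𝕜 V} {q : ι → Module.Dual 𝕜 V}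
    (h : ∀ v, (∀ i, q i v = 0) → f v = 0) : ∃ c : ι → 𝕜, ∀ v, f v = ∑ i, c i * q i v := by
  have hmem : f ∈ Submodule.span 𝕜 (Set.range q) :=
    mem_span_of_iInf_ker_le_ker fun v hv => h v fun i => (Submodule.mem_iInf _).1 hv i
  obtain ⟨c, rfl⟩ := (Submodule.mem_span_range_iff_exists_fun 𝕜).1 hmem
  exact ⟨c, fun v => by simp⟩

variable {n : ℕ} {M : Type*} [TopologicalSpace M] [ChartedSpace (EuclideanSpace ℝ (Fin n)) M]
  [IsManifold (𝓡 n) ∞ M] (g : RiemannianMetricOn n M) {k : ℕ}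

theorem gramian_apply (f h : Fin k → M → ℝ) (x : M) (a b : Fin k) :
    gramian g f h x a b = differential n (h b) x (grad g (f a) x) :=
  inner_grad g (h b) x _

theorem det_gramian_ne_zero {F : Fin k → M → ℝ} {x : M}
    (hF : Function.Surjective
      fun (v : TangentSpace (𝓡 n) x) (i : Fin k) => differential n (F i) x v) :
    (gramian g F F x).det ≠ 0 := by
  intro hdet
  obtain ⟨μ, hμ, hzero⟩ := Matrix.exists_mulVec_eq_zero_iff.2 hdet
  set u : TangentSpace (𝓡 n) x := ∑ b, μ b • grad g (F b) x with hu
  have hinner : ∀ w, g.inner x u w = ∑ b, μ b * differential n (F b) x w := fun w => by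
    simp only [hu, map_sum, map_smul, sum_apply, smul_apply, inner_grad, smul_eq_mul]
  have hgrad : ∀ a, g.inner x u (grad g (F a) x) = 0 := fun a => by
    rw [hinner]
    refine (Finset.sum_congr rfl fun b _ => ?_).trans (congrFun hzero a)
    exact (mul_comm _ _).trans (congrArg (· * μ b) (gramian_apply g F F x a b).symm)
  have hself : g.inner x u u = 0 := by
    conv_lhs => rw [hu, map_sum]
    exact Finset.sum_eq_zero fun a _ => by rw [map_smul, ← hu, hgrad, smul_zero]
  have hu0 : u = 0 := by_contra fun hne => (g.pos x u hne).ne' hself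
  obtain ⟨w, rfl⟩ := hF μ
  refine hμ (dotProduct_self_eq_zero.1 ((hinner w).symm.trans ?_))
  rw [hu0, map_zero, zero_apply]

theorem gramian_update {F : Fin k → M → ℝ} {G : M → ℝ} {x : M} {c : Fin k → ℝ}
    (hG : ∀ v, differential n G x v = ∑ i, c i * differential n (F i) x v) (i : Fin k) :
    gramian g F (Function.update F i G) x
      = (gramian g F F x).updateCol i ((gramian g F F x).mulVec c) := by
  ext a b
  rcases eq_or_ne b i with rfl | hb
  · rw [gramian_apply, Matrix.updateCol_self, Function.update_self, hG]
    exact Finset.sum_congr rfl fun j _ =>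
      (mul_comm _ _).trans (congrArg (· * c j) (gramian_apply g F F x a j).symm)
  · rw [gramian_apply, Matrix.updateCol_ne hb, Function.update_of_ne hb, gramian_apply]

theorem lagrangeMultiplier_eq {F : Fin k → M → ℝ} {G : M → ℝ} {x : M} {c : Fin k → ℝ}
    (hF : Function.Surjective
      fun (v : TangentSpace (𝓡 n) x) (i : Fin k) => differential n (F i) x v)
    (hG : ∀ v, differential n G x v = ∑ i, c i * differential n (F i) x v) (i : Fin k) :
    lagrangeMultiplier g F G i x = c i := by
  rw [lagrangeMultiplier, gramian_update g hG, ← Matrix.cramer_apply,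
    Matrix.cramer_eq_adjugate_mulVec, Matrix.mulVec_mulVec, Matrix.adjugate_mul,
    Matrix.smul_mulVec, Matrix.one_mulVec, Pi.smul_apply, smul_eq_mul,
    mul_div_cancel_left₀ _ (det_gramian_ne_zero g hF)]

theorem differential_eq_sum_lagrangeMultiplier {F : Fin k → M → ℝ} {G : M → ℝ} {x : M}
    (hF : Function.Surjective
      fun (v : TangentSpace (𝓡 n) x) (i : Fin k) => differential n (F i) x v)
    (hker : ∀ v, (∀ i, differential n (F i) x v = 0) → differential n G x v = 0)
    (v : TangentSpace (𝓡 n) x) :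
    differential n G x v = ∑ i, lagrangeMultiplier g F G i x * differential n (F i) x v := by
  obtain ⟨c, hc⟩ := exists_eq_sum_of_forall_apply_eq_zero
    (f := (mfderiv (𝓡 n) 𝓘(ℝ, ℝ) G x).toLinearMap)
    (q := fun i => (mfderiv (𝓡 n) 𝓘(ℝ, ℝ) (F i) x).toLinearMap) hker
  simp only [lagrangeMultiplier_eq g hF hc]
  exact hc v

end LagrangeMultipliers

section SmoothVectorFields

variable {n : ℕ} {M : Type*} [TopologicalSpace M] [ChartedSpace (EuclideanSpace ℝ (Fin n)) M]
  [IsManifold (𝓡 n) ∞ M] [T2Space M]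

theorem exists_smoothFun_eventuallyEq_extChartAt (x : M) (i : Fin n) :
    ∃ f : SmoothFun n M, ∀ᶠ p in 𝓝 x, f =ᶠ[𝓝 p] fun q => extChartAt (𝓡 n) x q i := by
  obtain ⟨ρ⟩ : Nonempty (SmoothBumpFunction (𝓡 n) x) := inferInstance
  have hcoord : ContMDiffOn (𝓡 n) 𝓘(ℝ, ℝ) ∞ (fun p => extChartAt (𝓡 n) x p i)
      (chartAt (EuclideanSpace ℝ (Fin n)) x).source :=
    (EuclideanSpace.proj (𝕜 := ℝ) i).contDiff.contMDiff.comp_contMDiffOn contMDiffOn_extChartAt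
  refine ⟨⟨_, ρ.contMDiff_smul hcoord⟩, ?_⟩
  filter_upwards [eventually_eventually_nhds.2 ρ.eventuallyEq_one] with p hp
  filter_upwards [hp] with q hq
  exact (congrArg (· • _) hq).trans (one_smul ℝ _)

theorem contMDiff_of_forall_contMDiff_differential {X : ∀ x : M, TangentSpace (𝓡 n) x}
    (hX : ∀ f : SmoothFun n M, ContMDiff (𝓡 n) 𝓘(ℝ, ℝ) ∞ fun x => differential n f x (X x)) :
    ContMDiff (𝓡 n) (𝓡 n).tangent ∞ (T% X) := by
  intro x
  refine Bundle.contMDiffAt_section _ |>.2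
    ((EuclideanSpace.equiv (Fin n) ℝ).symm.contDiff.contMDiff.contMDiffAt.comp x
      (contMDiffAt_pi_space.2 fun i => ?_))
  obtain ⟨f, hf⟩ := exists_smoothFun_eventuallyEq_extChartAt (n := n) x i
  refine (hX f x).congr_of_eventuallyEq ?_
  filter_upwards [hf, extChartAt_source_mem_nhds (I := 𝓡 n) x] with p hfp hp
  have hsource : p ∈ (chartAt (EuclideanSpace ℝ (Fin n)) x).source := by
    simpa only [extChartAt_source] using hp
  have hchart : MDifferentiableAt (𝓡 n) 𝓘(ℝ, EuclideanSpace ℝ (Fin n)) (extChartAt (𝓡 n) x) p :=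
    mdifferentiableAt_extChartAt hsource
  have hcoord := HasMFDerivAt.comp p
    (EuclideanSpace.proj (𝕜 := ℝ) i).hasFDerivAt.hasMFDerivAt hchart.hasMFDerivAt
  have hderiv := TangentBundle.continuousLinearMapAt_trivializationAt (I := 𝓡 n) hsource
  have htriv := (DFunLike.congr_fun hderiv (X p)).symm.trans
    (Bundle.Trivialization.continuousLinearMapAt_apply_of_mem ℝ _ hsource (X p))
  refine (congrArg (fun v : EuclideanSpace ℝ (Fin n) => v i) htriv.symm).trans ?_
  exact (DFunLike.congr_fun (hfp.mfderiv_eq.trans hcoord.mfderiv) (X p)).symm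

end SmoothVectorFields

section RegularLeaves

theorem exists_curve_in_level {E F : Type*} [NormedAddCommGroup E] [NormedSpace ℝ E]
    [CompleteSpace E] [NormedAddCommGroup F] [NormedSpace ℝ F] [FiniteDimensional ℝ F]
    {f : E → F} {f' : E →L[ℝ] F} {a : E} (hf : HasStrictFDerivAt f f' a)
    (hsurj : Function.Surjective f') {v : E} (hv : f' v = 0) :
    ∃ c : ℝ → E, c 0 = a ∧ (∀ᶠ t in 𝓝 0, f (c t) = f a) ∧ HasDerivAt c v 0 := by
  have : CompleteSpace F := FiniteDimensional.complete ℝ F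
  have hrange : f'.range = ⊤ := LinearMap.range_eq_top.2 hsurj
  let w : f'.ker := ⟨v, hv⟩
  have hline : HasDerivAt (fun t : ℝ => t • w) w 0 := by
    simpa using (hasDerivAt_id (0 : ℝ)).smul_const w
  have hzero : (fun t : ℝ => t • w) 0 = 0 := zero_smul ℝ w
  refine ⟨fun t => hf.implicitFunction f f' hrange (f a) (t • w), ?_, ?_, ?_⟩
  · simp [hf.implicitFunction_apply_image hrange]
  · have hlim : Filter.Tendsto (fun t : ℝ => t • w) (𝓝 0) (𝓝 0) :=
      hzero ▸ hline.continuousAt.tendsto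
    exact (tendsto_const_nhds.prodMk_nhds hlim).eventually (hf.map_implicitFunction_eq hrange)
  · have himplicit := (hf.to_implicitFunction hrange).hasFDerivAt
    rw [← hzero] at himplicit
    exact himplicit.comp_hasDerivAt (0 : ℝ) hline

variable {n : ℕ} {M : Type*} [TopologicalSpace M] [ChartedSpace (EuclideanSpace ℝ (Fin n)) M]
  {k : ℕ} {C : Fin k → SmoothFun n M}

theorem mem_tangentTo_levelSet [IsManifold (𝓡 n) ∞ M] {c : Fin k → ℝ} {U : Set M} (hU : IsOpen U)
    {x : M} (hx : x ∈ U ∩ levelSet C c)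
    (hsurj : Function.Surjective
      fun (v : TangentSpace (𝓡 n) x) (i : Fin k) => differential n (C i) x v)
    {v : TangentSpace (𝓡 n) x} (hv : ∀ i, differential n (C i) x v = 0) :
    v ∈ tangentTo (n := n) (U ∩ levelSet C c) x := by
  have hstrict : HasStrictFDerivAt (fun y i => localRep x (C i) y)
      (ContinuousLinearMap.pi fun i => fderiv ℝ (localRep x (C i)) (extChartAt (𝓡 n) x x))
      (extChartAt (𝓡 n) x x) :=
    hasStrictFDerivAt_pi.2 fun i => (contDiffAt_localRep x (C i)).hasStrictFDerivAt (by simp)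
  obtain ⟨γ, h0, hlevel, hγ⟩ := exists_curve_in_level (v := (v : EuclideanSpace ℝ (Fin n))) hstrict
    (fun b => (hsurj b).imp fun w hw => (funext fun i =>
      (differential_eq_fderiv_localRep x (C i) w).symm).trans hw)
    (funext fun i => (differential_eq_fderiv_localRep x (C i) v).symm.trans (hv i))
  have hbase : (extChartAt (𝓡 n) x).symm (γ 0) = x := by rw [h0, extChartAt_to_inv]
  have hderiv : HasMFDerivAt 𝓘(ℝ, ℝ) (𝓡 n) ((extChartAt (𝓡 n) x).symm ∘ γ) 0
      ((1 : ℝ →L[ℝ] ℝ).smulRight v : ℝ →L[ℝ] TangentSpace (𝓡 n) x) :=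
    have : IsManifold (𝓡 n) 1 M := .of_le (n := ∞) (by simp)
    hasMFDerivAt_extChartAt_symm_comp (h0 ▸ mem_extChartAt_target x) hbase
      (hγ.congr_deriv (coords_eq_self x v).symm)
  refine ⟨_, hbase, ?_, hderiv⟩
  have hmem : U ∈ 𝓝 (((extChartAt (𝓡 n) x).symm ∘ γ) 0) :=
    hU.mem_nhds (Set.mem_of_eq_of_mem hbase hx.1)
  filter_upwards [hlevel, hderiv.continuousAt.eventually_mem hmem] with t hlevel_t hU_t
  refine ⟨hU_t, fun i => (congrFun hlevel_t i).trans ?_⟩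
  rw [localRep, Function.comp_apply, extChartAt_to_inv]
  exact hx.2 i

variable {P : PoissonStructure n M} {S : Set M} {x : M}

theorem IsRegularSymplecticLeaf.surjective_differential (hS : IsRegularSymplecticLeaf P C S)
    (hx : x ∈ S) : Function.Surjective
      fun (v : TangentSpace (𝓡 n) x) (i : Fin k) => differential n (C i) x v := by
  obtain ⟨c, hc, U, -, rfl⟩ := hS.isOpen_in_regular_level
  exact hc x hx.2

theorem IsRegularSymplecticLeaf.mem_tangentTo [IsManifold (𝓡 n) ∞ M]
    (hS : IsRegularSymplecticLeaf P C S) (hx : x ∈ S) {v : TangentSpace (𝓡 n) x}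
    (hv : ∀ i, differential n (C i) x v = 0) : v ∈ tangentTo (n := n) S x := by
  have hsurj := hS.surjective_differential hx
  obtain ⟨c, -, U, hU, rfl⟩ := hS.isOpen_in_regular_level
  exact mem_tangentTo_levelSet hU hx hsurj hv

end RegularLeaves

section HamiltonianVectorFields

variable {n : ℕ} {M : Type*} [TopologicalSpace M] [ChartedSpace (EuclideanSpace ℝ (Fin n)) M]
  {P : PoissonStructure n M} {H : SmoothFun n M} {X : ∀ x : M, TangentSpace (𝓡 n) x}

namespace PoissonStructure

theorem IsHamiltonianVectorField.contMDiff [IsManifold (𝓡 n) ∞ M] [T2Space M]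
    (hX : P.IsHamiltonianVectorField H X) : ContMDiff (𝓡 n) (𝓡 n).tangent ∞ (T% X) :=
  contMDiff_of_forall_contMDiff_differential fun f =>
    (P.bracket f H).contMDiff.congr fun x => hX f x

theorem IsHamiltonianVectorField.mem_firstIntegrals (hX : P.IsHamiltonianVectorField H X) :
    H ∈ firstIntegrals X := fun x => by
  rw [hX H x]
  exact self_eq_neg.1 (DFunLike.congr_fun (P.skew H H) x)

theorem IsCasimir.mem_firstIntegrals {C : SmoothFun n M} (hC : P.IsCasimir C)
    (hX : P.IsHamiltonianVectorField H X) : C ∈ firstIntegrals X := fun x => by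
  rw [hX C x, hC H]
  rfl

theorem IsHamiltonianVectorField.differential_eq_zero_of_mem_characteristicSpace
    (hX : P.IsHamiltonianVectorField H X) {x : M} (hx : X x = 0) {v : TangentSpace (𝓡 n) x}
    (hv : v ∈ P.characteristicSpace x) : differential n H x v = 0 := by
  obtain ⟨f, hf⟩ := hv
  have hbracket : P.bracket f H x = 0 := by
    rw [← hX f x, hx]
    exact map_zero _
  rw [hf H, P.skew H f]
  exact neg_eq_zero.2 hbracket

end PoissonStructure

end HamiltonianVectorFields

end HamiltonPoisson

end

open HamiltonPoisson in
theorem theorem5p2_general {n : ℕ} {M : Type*} [TopologicalSpace M]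
    [ChartedSpace (EuclideanSpace ℝ (Fin n)) M] [IsManifold (𝓡 n) ∞ M] [T2Space M]
    (g : RiemannianMetricOn n M) {k : ℕ} {C : Fin k → SmoothFun n M} {H : SmoothFun n M}
    {X : ∀ x : M, TangentSpace (𝓡 n) x} (hX : ContMDiff (𝓡 n) (𝓡 n).tangent 1 (T% X))
    (hC : ∀ i, C i ∈ firstIntegrals X) (hH : H ∈ firstIntegrals X) {xe : M} (heq : X xe = 0)
    (hsurj : Function.Surjective
      fun (v : TangentSpace (𝓡 n) xe) (i : Fin k) => differential n (C i) xe v)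
    (hker : ∀ v, (∀ i, differential n (C i) xe v = 0) → differential n H xe v = 0)
    (hpos : ∀ v ≠ 0, (∀ i, differential n (C i) xe v = 0) →
      0 < hess g H xe v v
        - ∑ i, lagrangeMultiplier g (fun j => (C j : M → ℝ)) H i xe * hess g (C i) xe v v) :
    IsStableEquilibrium X xe := by
  set c := fun i => lagrangeMultiplier g (fun j => (C j : M → ℝ)) H i xe
  have hlinear : ∀ {φ : SmoothFun n M → ℝ}, IsLinearMap ℝ φ →
      φ (H - ∑ i, c i • C i) = φ H - ∑ i, c i * φ (C i) := fun {φ} hφ => by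
    simpa using map_sub (hφ.mk' φ) H (∑ i, c i • C i)
  refine isStableEquilibrium_of_hess_pos g hX heq (L := H - ∑ i, c i • C i)
    (sub_mem hH (sum_mem fun i _ => Subalgebra.smul_mem _ (hC i) (c i))) hC (fun v => ?_)
    fun v hv hvC => ?_
  · rw [hlinear (isLinearMap_differential xe v), sub_eq_zero]
    exact differential_eq_sum_lagrangeMultiplier g hsurj hker v
  · rw [hlinear (isLinearMap_hess g xe v v)]
    exact hpos v hv hvC

open HamiltonPoisson in
theorem theorem5p2 {n : ℕ} {M : Type*} [TopologicalSpace M]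
    [ChartedSpace (EuclideanSpace ℝ (Fin n)) M] [IsManifold (𝓡 n) ∞ M]
    [T2Space M] [ParacompactSpace M]
    (P : PoissonStructure n M) (g : RiemannianMetricOn n M)
    {k : ℕ} (C : Fin k → SmoothFun n M) (hC : ∀ i, P.IsCasimir (C i))
    (H : SmoothFun n M) (X_H : ∀ x : M, TangentSpace (𝓡 n) x)
    (hX : P.IsHamiltonianVectorField H X_H)
    (S : Set M) (hS : IsRegularSymplecticLeaf P C S)
    (xe : M) (hxe : xe ∈ S) (heq : X_H xe = 0)
    (hpos : ∀ v ∈ tangentTo (n := n) S xe, v ≠ 0 →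
      0 < hess g H xe v v
        - ∑ i, lagrangeMultiplier g (fun j => (C j : M → ℝ)) H i xe * hess g (C i) xe v v) :
    IsStableEquilibrium X_H xe := by
  have htangent : ∀ v, (∀ i, differential n (C i) xe v = 0) → v ∈ tangentTo (n := n) S xe :=
    fun _ hv => hS.mem_tangentTo hxe hv
  exact theorem5p2_general g (hX.contMDiff.of_le (by simp)) (fun i => (hC i).mem_firstIntegrals hX)
    hX.mem_firstIntegrals heq (hS.surjective_differential hxe)
    (fun v hv => hX.differential_eq_zero_of_mem_characteristicSpace heq
      (hS.tangent_eq xe hxe ▸ htangent v hv))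
    fun v hv hvC => hpos v (htangent v hvC) hv
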